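/- Proposition. Let $N\ge 1$ and let $H:\mathbf{R}^N\to(0,1)$ be a measurable function; $\|\cdot\|$ and $\langle\cdot,\cdot\rangle$ are Euclidean. A complex isonormal process is a centered complex Gaussian process $W=\{W(f);\,f\in L^2_{\mathbf{C}}(\mathbf{R}^N)\}$ on a probability space with $E[W(f)\overline{W(g)}]=\int_{\mathbf{R}^N} f(u)\overline{g(u)}\,du$ for all $f,g$. A process $\hat W$ is the Fourier transform of $W$ if $\hat W(f)=W(\hat f)$ almost surely for every $f\in L^2_{\mathbf{C}}(\mathbf{R}^N)$, where $\hat f$ is the $L^2$ Fourier transform with the normalization $\hat f(x)=\int e^{-i\langle x,u\rangle}f(u)\,du$. One writes $\int f(u)\,\mathbb{W}(du)=W(f)$ and $\int f(\xi)\,\hat{\mathbb{W}}(d\xi)=\hat W(f)$. For every $t\in\mathbf{R}^N$ the kernels $u\mapsto\|t-u\|^{H(t)-N/2}-\|u\|^{H(t)-N/2}$ and $\xi\mapsto \dfrac{e^{i\langle t,\xi\rangle}-1}{\|\xi\|^{H(t)+N/2}}$ are square integrable on $\mathbf{R}^N$. Moreover there is a deterministic function $c:\mathbf{R}^N\to\mathbf{R}$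 (depending only on $N$ and $H$), with $c(t)\ne0$ for every $t$ except possibly where $N=1$ and $H(t)=\tfrac12$, such that the following holds for every complex isonormal process $W$ with Fourier transform $\hat W$, and every index set $T\subseteq\mathbf{R}^N$ (in particular for $T=\mathbf{R}^N_+$ and $T=\mathbf{R}^N$). Consider the harmonizable process and the multifractional Brownian field $$X_t=\int_{\mathbf{R}^N}\frac{e^{i\langle t,\xi\rangle}-1}{\|\xi\|^{H(t)+N/2}}\,\hat{\mathbb{W}}(d\xi),\qquad Y_t=\int_{\mathbf{R}^N}\Big[\|t-u\|^{H(t)-N/2}-\|u\|^{H(t)-N/2}\Big]\mathbb{W}(du),\qquad t\in T,$$ where a version of $X$ (of $Y$) is any process $(X_t)_{t\in T}$ (any process $(Y_t)_{t\in T}$) that satisfies the displayed equality almost surely for each fixed $t\in T$. Then: (i) for all versions $X$ and $Y$ and every $t\in T$, $Y_t=c(t)X_t$ almost surely; (ii) there are versions $X$ and $Y$ for which $Y$ and $cX$ are indistinguishable, i.e. almost surely $Y_t=c(t)X_t$ for all $t\in T$ simultaneously; (iii) whenever $X$ and $Y$ are versions whose paths are almost surely continuous on $T$, $Y$ and $cX$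 are indistinguishable. -/

import Mathlib

open MeasureTheory ProbabilityTheory
open scoped FourierTransform ComplexConjugate

noncomputable section

/-- The Hilbert space `L²_ℂ(ℝ^N)` (with Lebesgue measure, and the Euclidean norm on `ℝ^N`). -/
abbrev L2C (N : ℕ) : Type := Lp (α := EuclideanSpace ℝ (Fin N)) ℂ 2

/-- The dilation `x ↦ (2π)⁻¹ x` preserves square integrability. -/
theorem memLp_comp_two_pi_inv_smul {N : ℕ} (g : L2C N) :
    MemLp (fun x : EuclideanSpace ℝ (Fin N) => g ((2 * Real.pi)⁻¹ • x)) 2 volume := by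
  have hr : (2 * Real.pi)⁻¹ ≠ 0 := by positivity
  have hm : Measurable (fun x : EuclideanSpace ℝ (Fin N) => (2 * Real.pi)⁻¹ • x) :=
    measurable_const_smul _
  have hg : MemLp g 2
      (Measure.map (fun x : EuclideanSpace ℝ (Fin N) => (2 * Real.pi)⁻¹ • x) volume) := by
    rw [Measure.map_addHaar_smul volume hr]
    exact (Lp.memLp g).smul_measure ENNReal.ofReal_ne_top
  exact hg.comp_of_map hm.aemeasurable

/-- The Fourier transform on `L²_ℂ(ℝ^N)`, normalised as
`f̂(x) = ∫ exp(-i⟨x,u⟩) f(u) du` on integrable functions.  Mathlib's `𝓕` on `L²` extends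
`∫ exp(-2πi⟨x,u⟩) f(u) du`, hence the dilation by `(2π)⁻¹`. -/
def fourierL2 {N : ℕ} (f : L2C N) : L2C N :=
  (memLp_comp_two_pi_inv_smul (𝓕 f)).toLp
    (fun x : EuclideanSpace ℝ (Fin N) => (𝓕 f : L2C N) ((2 * Real.pi)⁻¹ • x))

/-- A complex isonormal process on `ℝ^N`: a centred (complex valued) Gaussian process
`{W(f) ; f ∈ L²_ℂ(ℝ^N)}` with `E[W(f) conj(W(g))] = ∫ f(u) conj(g(u)) du`. -/
structure IsComplexIsonormal {N : ℕ} {Ω : Type*} [MeasurableSpace Ω] (P : Measure Ω)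
    (W : L2C N → Ω → ℂ) : Prop where
  gaussian : IsGaussianProcess W P
  centered : ∀ f, ∫ ω, W f ω ∂P = 0
  covariance : ∀ f g, ∫ ω, W f ω * conj (W g ω) ∂P = ∫ u, f u * conj (g u)

/-- The process `V` is the Fourier transform of the process `W`: `V(f) = W(f̂)` almost surely,
for every `f ∈ L²_ℂ(ℝ^N)`. -/
def IsFourierTransformOf {N : ℕ} {Ω : Type*} [MeasurableSpace Ω] (P : Measure Ω)
    (V W : L2C N → Ω → ℂ) : Prop :=
  ∀ f, V f =ᵐ[P] W (fourierL2 f)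

open Classical in
/-- The integral `∫ f(u) 𝕎(du) = W(f)` of a square integrable function against the random
measure `𝕎(E) = W(1_E)` (zero by convention if `f` is not square integrable). -/
def noiseIntegral {N : ℕ} {Ω : Type*} (W : L2C N → Ω → ℂ)
    (f : EuclideanSpace ℝ (Fin N) → ℂ) : Ω → ℂ :=
  if hf : MemLp f 2 volume then W (hf.toLp f) else 0

/-- The moving average kernel `u ↦ ‖t-u‖^(h-N/2) - ‖u‖^(h-N/2)`. -/
def movingAverageKernel (N : ℕ) (h : ℝ) (t u : EuclideanSpace ℝ (Fin N)) : ℂ :=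
  ((‖t - u‖ ^ (h - (N : ℝ) / 2) - ‖u‖ ^ (h - (N : ℝ) / 2) : ℝ) : ℂ)

/-- The harmonizable kernel `ξ ↦ (exp(i⟨t,ξ⟩) - 1) / ‖ξ‖^(h+N/2)`. -/
def harmonizableKernel (N : ℕ) (h : ℝ) (t ξ : EuclideanSpace ℝ (Fin N)) : ℂ :=
  (Complex.exp (Complex.I * ((inner ℝ t ξ : ℝ) : ℂ)) - 1) /
    ((‖ξ‖ ^ (h + (N : ℝ) / 2) : ℝ) : ℂ)

/-- `Y`, restricted to the index set `T`, is the multifractional Brownian field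
`Y_t = ∫ (‖t-u‖^(H(t)-N/2) - ‖u‖^(H(t)-N/2)) 𝕎(du)`: the equality of random variables holds
almost surely, for each `t ∈ T`. -/
def IsMovingAverageField {N : ℕ} {Ω : Type*} [MeasurableSpace Ω] (P : Measure Ω)
    (W : L2C N → Ω → ℂ) (H : EuclideanSpace ℝ (Fin N) → ℝ)
    (T : Set (EuclideanSpace ℝ (Fin N))) (Y : EuclideanSpace ℝ (Fin N) → Ω → ℂ) : Prop :=
  ∀ t ∈ T, Y t =ᵐ[P] noiseIntegral W (movingAverageKernel N (H t) t)

/-- `X`, restricted to the index set `T`, is the harmonizable process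
`X_t = ∫ (exp(i⟨t,ξ⟩) - 1) / ‖ξ‖^(H(t)+N/2) 𝕍(dξ)`: the equality of random variables holds
almost surely, for each `t ∈ T`. -/
def IsHarmonizableField {N : ℕ} {Ω : Type*} [MeasurableSpace Ω] (P : Measure Ω)
    (V : L2C N → Ω → ℂ) (H : EuclideanSpace ℝ (Fin N) → ℝ)
    (T : Set (EuclideanSpace ℝ (Fin N))) (X : EuclideanSpace ℝ (Fin N) → Ω → ℂ) : Prop :=
  ∀ t ∈ T, X t =ᵐ[P] noiseIntegral V (harmonizableKernel N (H t) t)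

/-- `X` and `Y` are indistinguishable on the index set `T`. -/
def IndistinguishableOn {N : ℕ} {Ω : Type*} [MeasurableSpace Ω] (P : Measure Ω)
    (T : Set (EuclideanSpace ℝ (Fin N))) (X Y : EuclideanSpace ℝ (Fin N) → Ω → ℂ) : Prop :=
  ∀ᵐ ω ∂P, ∀ t ∈ T, X t ω = Y t ω

end

/-! Fix `t`, `h = H t`, and put `s = (h + N/2)/2`, `p = (h - N/2)/2`. Everything rests on one
deterministic fact: for `p ≠ 0`, the Fourier transform of the harmonizable kernel is a nonzero real
multiple, independent of `t`, of the moving average kernel (`fourierL2_toLp_harmonizableKernel`).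
The Gamma integral writes `‖ξ‖^(-2s)` as a superposition of Gaussians `r^(s-1) exp(-r‖ξ‖²)`. Each
Gaussian times `exp(i⟨t,ξ⟩) - 1` has an explicit transform, a difference of two Gaussians, and
integrating over `r` gives a difference of powers with exponent `p`. The kernel need not be
integrable, so `r` is cut off to `[1/(n+1), n+1]` and the limit is taken in `L²`
(`fourier_toLp_ae_eq_of_dominated`). Covariance alone makes `W` homogeneous almost surely, so the
identity of kernels becomes `Y t = c t * X t` almost surely. For continuous versions, `H` is merely
measurable, but `c = Y / X` inherits continuity from the paths wherever `X t` is not almost surely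
zero, that is off `t = 0`. A countable dense set then suffices (`ae_forall_eq_mul_of_continuousOn`).
-/

/-! ### Computing `L²` Fourier transforms by dominated limits. -/

theorem tendsto_toLp_of_dominated {α E : Type*} {mα : MeasurableSpace α} {μ : Measure α}
    [NormedAddCommGroup E] {f : ℕ → α → E} {g : α → E} {b : α → ℝ}
    (hf : ∀ n, MemLp (f n) 2 μ) (hg : MemLp g 2 μ) (hb : MemLp b 2 μ)
    (hle : ∀ n, ∀ᵐ x ∂μ, ‖f n x‖ ≤ b x)
    (hlim : ∀ᵐ x ∂μ, Filter.Tendsto (fun n => f n x) Filter.atTop (nhds (g x))) :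
    Filter.Tendsto (fun n => (hf n).toLp (f n)) Filter.atTop (nhds (hg.toLp g)) := by
  have hle_lim : ∀ᵐ x ∂μ, ‖g x‖ ≤ b x := by
    filter_upwards [hlim, ae_all_iff.2 hle] with x h1 h2
    exact le_of_tendsto h1.norm (Filter.Eventually.of_forall h2)
  rw [Lp.tendsto_Lp_iff_tendsto_eLpNorm'']
  have key : Filter.Tendsto (fun n => ∫⁻ x, ‖f n x - g x‖ₑ ^ (2 : ℝ) ∂μ) Filter.atTop
      (nhds (∫⁻ _, 0 ∂μ)) := by
    refine tendsto_lintegral_of_dominated_convergence'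
      (fun x => ‖(2 : ℝ) * b x‖ₑ ^ (2 : ℝ)) ?_ ?_ ?_ ?_
    · exact fun n => ((hf n).1.sub hg.1).enorm.pow_const _
    · intro n
      filter_upwards [hle n, hle_lim] with x h1 h2
      refine ENNReal.rpow_le_rpow ?_ (by norm_num)
      rw [← ofReal_norm, ← ofReal_norm]
      refine ENNReal.ofReal_le_ofReal ?_
      calc ‖f n x - g x‖ ≤ ‖f n x‖ + ‖g x‖ := norm_sub_le _ _
        _ ≤ 2 * b x := by linarith
        _ ≤ ‖2 * b x‖ := Real.le_norm_self _
    · have := (hb.const_mul (2 : ℝ)).2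
      exact (lintegral_rpow_enorm_lt_top_of_eLpNorm_lt_top (by norm_num) (by norm_num) this).ne
    · filter_upwards [hlim] with x hx
      have h0 : Filter.Tendsto (fun n => ‖f n x - g x‖ₑ) Filter.atTop (nhds 0) := by
        simpa using (hx.sub_const (g x)).enorm
      have h2 := (ENNReal.continuous_rpow_const (y := 2)).continuousAt.tendsto.comp h0
      simpa [Function.comp_def] using h2
  simp only [lintegral_zero] at key
  have h2 := (ENNReal.continuous_rpow_const (y := 1 / 2)).continuousAt.tendsto.comp key
  simp only [Function.comp_def] at h2
  have e0 : (0 : ENNReal) ^ (1 / 2 : ℝ) = 0 := by simp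
  rw [e0] at h2
  refine h2.congr fun n => ?_
  rw [eLpNorm_eq_lintegral_rpow_enorm_toReal (by norm_num) (by norm_num)]
  simp

/-- On `L¹ ∩ L²` the Fourier transform is given by the Fourier integral. -/
theorem fourier_toLp_ae_eq {N : ℕ} {f : EuclideanSpace ℝ (Fin N) → ℂ}
    (hf1 : Integrable f) (hf2 : MemLp f 2 volume) :
    (𝓕 (hf2.toLp f) : L2C N) =ᵐ[volume] 𝓕 f := by
  have hcont : Continuous (𝓕 f) :=
    VectorFourier.fourierIntegral_continuous Real.continuous_fourierChar
      continuous_inner hf1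
  refine ae_eq_of_integral_contDiff_smul_eq
    ((Lp.memLp _).locallyIntegrable (by norm_num)) hcont.locallyIntegrable fun g hg hgc => ?_
  have hg₁ : HasCompactSupport (Complex.ofRealCLM ∘ g) := hgc.comp_left rfl
  have hg₂ : ContDiff ℝ (⊤ : ℕ∞) (Complex.ofRealCLM ∘ g) := by fun_prop
  set φ := hg₁.toSchwartzMap hg₂ with hφ
  have hφg : ∀ x, φ x = (g x : ℂ) := fun x => rfl
  -- Both transforms, tested against `φ`, reduce to `∫ f · 𝓕 φ`: one by duality of tempered
  -- distributions, the other by Fubini.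
  have h1 := DFunLike.congr_fun (Lp.fourier_toTemperedDistribution_eq (hf2.toLp f)) φ
  rw [TemperedDistribution.fourier_apply, Lp.toTemperedDistribution_apply,
    Lp.toTemperedDistribution_apply] at h1
  have h2 : ∫ ξ, (𝓕 f ξ) • φ ξ = ∫ x, f x • (𝓕 (φ : EuclideanSpace ℝ (Fin N) → ℂ)) x := by
    simpa using! (VectorFourier.integral_fourierIntegral_smul_eq_flip
      (L := innerₗ (EuclideanSpace ℝ (Fin N))) Real.continuous_fourierChar continuous_inner
      hf1 φ.integrable)
  calc ∫ x, g x • (𝓕 (hf2.toLp f) : L2C N) x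
      = ∫ x, φ x • (𝓕 (hf2.toLp f) : L2C N) x := by
        refine integral_congr_ae (Filter.Eventually.of_forall fun x => ?_)
        simp [hφg]
    _ = ∫ x, (𝓕 φ) x • (hf2.toLp f) x := h1.symm
    _ = ∫ x, f x • (𝓕 (φ : EuclideanSpace ℝ (Fin N) → ℂ)) x := by
        refine integral_congr_ae ?_
        filter_upwards [hf2.coeFn_toLp] with x hx
        rw [hx, SchwartzMap.fourier_coe, smul_eq_mul, smul_eq_mul, mul_comm]
    _ = ∫ ξ, (𝓕 f ξ) • φ ξ := h2.symm
    _ = ∫ x, g x • 𝓕 f x := by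
        refine integral_congr_ae (Filter.Eventually.of_forall fun x => ?_)
        simp [hφg, mul_comm]

/-- The `L²` Fourier transform of a dominated limit of integrable functions is the pointwise limit
of the Fourier integrals. -/
theorem fourier_toLp_ae_eq_of_dominated {N : ℕ} {f : ℕ → EuclideanSpace ℝ (Fin N) → ℂ}
    {k g : EuclideanSpace ℝ (Fin N) → ℂ} (hf1 : ∀ n, Integrable (f n)) (hk : MemLp k 2 volume)
    (hle : ∀ n, ∀ᵐ x, ‖f n x‖ ≤ ‖k x‖)
    (hlim : ∀ᵐ x, Filter.Tendsto (fun n => f n x) Filter.atTop (nhds (k x)))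
    (hF : ∀ᵐ x, Filter.Tendsto (fun n => 𝓕 (f n) x) Filter.atTop (nhds (g x))) :
    (𝓕 (hk.toLp k) : L2C N) =ᵐ[volume] g := by
  have hf2 : ∀ n, MemLp (f n) 2 volume := fun n => hk.mono (hf1 n).1 (hle n)
  have h1 := tendsto_toLp_of_dominated hf2 hk hk.norm hle hlim
  have h2 : Filter.Tendsto (fun n => (𝓕 ((hf2 n).toLp (f n)) : L2C N)) Filter.atTop
      (nhds (𝓕 (hk.toLp k))) :=
    ((Lp.fourierTransformₗᵢ (EuclideanSpace ℝ (Fin N)) ℂ).continuous.tendsto _).comp h1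
  -- `L²` convergence gives pointwise convergence only along a subsequence, which is enough to
  -- identify the limit with `g`.
  obtain ⟨φ, hφ, hφ'⟩ := (tendstoInMeasure_of_tendsto_Lp h2).exists_seq_tendsto_ae
  filter_upwards [hφ', hF, ae_all_iff.2 fun n => fourier_toLp_ae_eq (hf1 n) (hf2 n)]
    with x hx1 hx2 hx3
  simp only [hx3] at hx1
  exact tendsto_nhds_unique hx1 (hx2.comp hφ.tendsto_atTop)

/-! ### Isonormal processes and continuous versions. -/

section IsonormalFields

open scoped InnerProductSpace

section ComplexIsonormal

variable {N : ℕ} {Ω : Type*} [MeasurableSpace Ω] {P : Measure Ω} {W : L2C N → Ω → ℂ}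

theorem IsComplexIsonormal.memLp (hW : IsComplexIsonormal P W) (f : L2C N) : MemLp (W f) 2 P :=
  (hW.gaussian.hasGaussianLaw_eval f).memLp_two

theorem IsComplexIsonormal.inner_toLp (hW : IsComplexIsonormal P W) (f g : L2C N) :
    ⟪(hW.memLp f).toLp (W f), (hW.memLp g).toLp (W g)⟫_ℂ = ⟪f, g⟫_ℂ := by
  rw [L2.inner_def, L2.inner_def]
  simp only [RCLike.inner_apply]
  -- The inner product is conjugate-linear in its first slot, hence the swapped arguments.
  rw [← hW.covariance g f]
  refine integral_congr_ae ?_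
  filter_upwards [(hW.memLp f).coeFn_toLp, (hW.memLp g).coeFn_toLp] with ω h1 h2
  rw [h1, h2]

/-- Linearity is not part of the definition. Expanding the squared norm of `W (c • f) - c W f`
through the covariance gives zero. -/
theorem IsComplexIsonormal.map_smul (hW : IsComplexIsonormal P W) (c : ℂ) (f : L2C N) :
    W (c • f) =ᵐ[P] fun ω => c * W f ω := by
  have h : (hW.memLp (c • f)).toLp (W (c • f)) = c • (hW.memLp f).toLp (W f) := by
    rw [← sub_eq_zero, ← inner_self_eq_zero (𝕜 := ℂ)]
    simp only [inner_sub_left, inner_sub_right, inner_smul_left, inner_smul_right,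
      hW.inner_toLp]
    ring
  filter_upwards [(hW.memLp (c • f)).coeFn_toLp, (hW.memLp f).coeFn_toLp,
    Lp.coeFn_smul c ((hW.memLp f).toLp (W f))] with ω h1 h2 h3
  rw [← h1, h, h3, Pi.smul_apply, h2, smul_eq_mul]

theorem IsComplexIsonormal.eq_zero_of_ae_eq_zero (hW : IsComplexIsonormal P W) {f : L2C N}
    (hf : W f =ᵐ[P] 0) : f = 0 := by
  have h : (hW.memLp f).toLp (W f) = 0 := by
    rw [Lp.eq_zero_iff_ae_eq_zero]
    exact (hW.memLp f).coeFn_toLp.trans hf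
  rw [← inner_self_eq_zero (𝕜 := ℂ), ← hW.inner_toLp, h, inner_zero_left]

end ComplexIsonormal

/-- If `Y t = c t * X t` almost surely for each `t ∈ T`, where no `X t` vanishes almost surely and
`X`, `Y` have continuous paths, then `c` is continuous on `T`. -/
theorem continuousOn_of_ae_eq_mul {E Ω : Type*} [PseudoMetricSpace E] [MeasurableSpace Ω]
    {P : Measure Ω} {T : Set E} {c : E → ℂ} {X Y : E → Ω → ℂ}
    (hXY : ∀ t ∈ T, Y t =ᵐ[P] fun ω => c t * X t ω)
    (hX0 : ∀ t ∈ T, ¬ X t =ᵐ[P] 0)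
    (hX : ∀ᵐ ω ∂P, ContinuousOn (fun t => X t ω) T)
    (hY : ∀ᵐ ω ∂P, ContinuousOn (fun t => Y t ω) T) : ContinuousOn c T := by
  rw [continuousOn_iff_continuous_domRestrict]
  -- A sequence involves only countably many null sets, so a single `ω` with `X t ω ≠ 0` serves for
  -- all its terms, and `c` is the quotient of two paths near `t`.
  refine SeqContinuous.continuous fun x t hxt => ?_
  have hae : ∀ᵐ ω ∂P, (∀ n, Y (x n) ω = c (x n) * X (x n) ω) :=
    ae_all_iff.2 fun n => hXY (x n) (x n).2
  have hfreq : ∃ᵐ ω ∂P, X t ω ≠ 0 := fun h => hX0 t t.2 (by simpa [Filter.EventuallyEq] using h)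
  obtain ⟨ω, h0, h1, h2, h3, h4⟩ :=
    (hfreq.and_eventually (hae.and ((hXY t t.2).and (hX.and hY)))).exists
  rw [continuousOn_iff_continuous_domRestrict] at h3 h4
  have hXt : Filter.Tendsto (fun n => X (x n) ω) Filter.atTop (nhds (X t ω)) :=
    (h3.tendsto t).comp hxt
  have hYt : Filter.Tendsto (fun n => Y (x n) ω) Filter.atTop (nhds (Y t ω)) :=
    (h4.tendsto t).comp hxt
  have hq := hYt.div hXt h0
  rw [h2, mul_div_assoc, div_self h0, mul_one] at hq
  refine hq.congr' ?_
  filter_upwards [hXt.eventually_ne h0] with n hn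
  simp [h1 n, mul_div_assoc, div_self hn]

/-- Fields with continuous paths that agree almost surely at each point of `T` up to the factor
`c` agree almost surely on all of `T` simultaneously. -/
theorem ae_forall_eq_mul_of_continuousOn {E Ω : Type*} [PseudoMetricSpace E]
    [SecondCountableTopology E] [MeasurableSpace Ω]
    {P : Measure Ω} {T : Set E} {c : E → ℂ} {X Y : E → Ω → ℂ}
    (hXY : ∀ t ∈ T, Y t =ᵐ[P] fun ω => c t * X t ω)
    (hX0 : ∀ t ∈ T, ¬ X t =ᵐ[P] 0)
    (hX : ∀ᵐ ω ∂P, ContinuousOn (fun t => X t ω) T)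
    (hY : ∀ᵐ ω ∂P, ContinuousOn (fun t => Y t ω) T) :
    ∀ᵐ ω ∂P, ∀ t ∈ T, Y t ω = c t * X t ω := by
  have hc := continuousOn_of_ae_eq_mul hXY hX0 hX hY
  obtain ⟨D, hDc, hD⟩ := TopologicalSpace.exists_countable_dense T
  have := hDc.to_subtype
  have hae : ∀ᵐ ω ∂P, ∀ d : D, Y (d : T) ω = c (d : T) * X (d : T) ω :=
    ae_all_iff.2 fun d => hXY _ (d : T).2
  filter_upwards [hae, hX, hY] with ω h1 h2 h3 t ht
  rw [continuousOn_iff_continuous_domRestrict] at h2 h3 hc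
  have := Continuous.ext_on hD h3 (hc.mul h2) fun d hd => h1 ⟨d, hd⟩
  exact congrFun this ⟨t, ht⟩

end IsonormalFields

/-! ### Square integrability of the harmonizable kernel. -/

section Kernels

open Set

theorem norm_exp_I_mul_sub_one_sq_le (x : ℝ) :
    ‖Complex.exp (Complex.I * (x : ℂ)) - 1‖ ^ 2 ≤ min 4 (x ^ 2) := by
  have h1 : ‖Complex.exp (Complex.I * (x : ℂ)) - 1‖ ≤ 2 := by
    refine (norm_sub_le _ _).trans ?_
    rw [mul_comm, Complex.norm_exp_ofReal_mul_I]
    norm_num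
  have h2 : ‖Complex.exp (Complex.I * (x : ℂ)) - 1‖ ≤ |x| :=
    Real.norm_exp_I_mul_ofReal_sub_one_le
  refine le_min ?_ ?_
  · nlinarith [norm_nonneg (Complex.exp (Complex.I * (x : ℂ)) - 1)]
  · rw [← sq_abs x]
    gcongr

theorem measurable_harmonizableKernel (N : ℕ) (h : ℝ) (t : EuclideanSpace ℝ (Fin N)) :
    Measurable (harmonizableKernel N h t) := by
  unfold harmonizableKernel
  fun_prop

/-- The squared modulus has a radial majorant. In polar coordinates it is of order `y^(1-2h)` near
zero, integrable since `h < 1`, and `y^(-2h-1)` at infinity, integrable since `h > 0`. -/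
theorem memLp_harmonizableKernel {N : ℕ} (hN : 1 ≤ N) {h : ℝ} (hh : h ∈ Ioo (0 : ℝ) 1)
    (t : EuclideanSpace ℝ (Fin N)) : MemLp (harmonizableKernel N h t) 2 volume := by
  have : Nonempty (Fin N) := ⟨⟨0, hN⟩⟩
  rw [memLp_two_iff_integrable_sq_norm (measurable_harmonizableKernel N h t).aestronglyMeasurable]
  set φ : ℝ → ℝ := fun y => min 4 (‖t‖ ^ 2 * y ^ 2) * y ^ (-(2 * h + N)) with hφ
  have hφi : Integrable (fun ξ : EuclideanSpace ℝ (Fin N) => φ ‖ξ‖) := by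
    rw [integrable_fun_norm_addHaar, finrank_euclideanSpace_fin,
      ← Ioc_union_Ioi_eq_Ioi (zero_le_one' ℝ)]
    have hm : ∀ s : Set ℝ, AEStronglyMeasurable (fun y : ℝ => y ^ (N - 1) • φ y)
        (volume.restrict s) := fun s => by
      apply Measurable.aestronglyMeasurable
      fun_prop
    have hpow : ∀ y : ℝ, 0 < y → y ^ (N - 1) * y ^ (-(2 * h + N)) = y ^ (-2 * h - 1) := by
      intro y hy
      rw [← Real.rpow_natCast, ← Real.rpow_add hy, Nat.cast_sub hN]
      congr 1
      push_cast
      ring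
    have hnn : ∀ y : ℝ, 0 < y → 0 ≤ y ^ (N - 1) • φ y := by
      intro y hy
      simp only [hφ, smul_eq_mul]
      positivity
    refine IntegrableOn.union ?_ ?_
    · have hi : IntegrableOn (fun y : ℝ => ‖t‖ ^ 2 * y ^ (1 - 2 * h)) (Ioc 0 1) := by
        have := (intervalIntegral.intervalIntegrable_rpow' (a := 0) (b := 1)
          (r := 1 - 2 * h) (by linarith [hh.2])).const_mul (‖t‖ ^ 2)
        rwa [intervalIntegrable_iff_integrableOn_Ioc_of_le zero_le_one] at this
      refine hi.mono' (hm _) ((ae_restrict_iff' measurableSet_Ioc).2 (ae_of_all _ fun y hy => ?_))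
      rw [Real.norm_of_nonneg (hnn y hy.1)]
      calc y ^ (N - 1) • φ y
          = min 4 (‖t‖ ^ 2 * y ^ 2) * (y ^ (N - 1) * y ^ (-(2 * h + N))) := by
            simp only [hφ, smul_eq_mul]; ring
        _ ≤ (‖t‖ ^ 2 * y ^ 2) * (y ^ (N - 1) * y ^ (-(2 * h + N))) := by
            have := hy.1
            gcongr
            exact min_le_right _ _
        _ = ‖t‖ ^ 2 * y ^ (1 - 2 * h) := by
            rw [hpow y hy.1, mul_assoc, ← Real.rpow_natCast y 2, ← Real.rpow_add hy.1]
            congr 2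
            push_cast
            ring
    · have hi : IntegrableOn (fun y : ℝ => 4 * y ^ (-2 * h - 1)) (Ioi 1) :=
        (integrableOn_Ioi_rpow_of_lt (by linarith [hh.1]) one_pos).const_mul 4
      refine hi.mono' (hm _) ((ae_restrict_iff' measurableSet_Ioi).2 (ae_of_all _ fun y hy => ?_))
      have hy0 : 0 < y := one_pos.trans hy
      rw [Real.norm_of_nonneg (hnn y hy0)]
      calc y ^ (N - 1) • φ y
          = min 4 (‖t‖ ^ 2 * y ^ 2) * (y ^ (N - 1) * y ^ (-(2 * h + N))) := by
            simp only [hφ, smul_eq_mul]; ring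
        _ ≤ 4 * (y ^ (N - 1) * y ^ (-(2 * h + N))) := by
            gcongr
            exact min_le_left _ _
        _ = 4 * y ^ (-2 * h - 1) := by rw [hpow y hy0]
  refine hφi.mono' ((measurable_harmonizableKernel N h t).norm.pow_const 2).aestronglyMeasurable
    (ae_of_all _ fun ξ => ?_)
  rw [Real.norm_of_nonneg (by positivity)]
  have hden : (‖ξ‖ ^ (h + (N : ℝ) / 2)) ^ 2 = ‖ξ‖ ^ (2 * h + N) := by
    rw [← Real.rpow_natCast, ← Real.rpow_mul (norm_nonneg _)]
    congr 1
    push_cast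
    ring
  rw [harmonizableKernel, norm_div, div_pow, Complex.norm_real, Real.norm_of_nonneg (by positivity),
    hden, div_eq_mul_inv, ← Real.rpow_neg (norm_nonneg _)]
  refine mul_le_mul_of_nonneg_right ((norm_exp_I_mul_sub_one_sq_le _).trans ?_) (by positivity)
  refine min_le_min_left _ ?_
  rw [← mul_pow]
  exact sq_le_sq' (by linarith [neg_le_of_abs_le (abs_real_inner_le_norm t ξ)])
    (real_inner_le_norm t ξ)

/-! ### Frullani-type integrals. -/

theorem integrableOn_prod_rpow_mul_exp {p A B : ℝ} (hp : p < 1) (hA : 0 < A) :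
    Integrable (Function.uncurry fun x v : ℝ => v ^ (-p) * Real.exp (-(x * v)))
      ((volume.restrict (Ioc A B)).prod (volume.restrict (Ioi 0))) := by
  have h1 : IntegrableOn (fun v : ℝ => v ^ (-p) * Real.exp (-(A * v))) (Ioi 0) := by
    simpa using integrableOn_rpow_mul_exp_neg_mul_rpow (s := -p) (p := 1) (b := A)
      (by linarith) one_pos hA
  have h2 : Integrable (fun _ : ℝ => (1 : ℝ)) (volume.restrict (Ioc A B)) :=
    integrable_const _
  refine (h2.mul_prod h1).mono' (Measurable.aestronglyMeasurable (by fun_prop)) ?_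
  rw [Measure.prod_restrict, ae_restrict_iff' (measurableSet_Ioc.prod measurableSet_Ioi)]
  refine ae_of_all _ fun z hz => ?_
  have hz2 : 0 < z.2 := hz.2
  have hz1 : A ≤ z.1 := hz.1.1.le
  simp only [Function.uncurry]
  rw [Real.norm_of_nonneg (by positivity), one_mul]
  gcongr

theorem integral_Ioc_exp_neg_mul {A B v : ℝ} (hAB : A ≤ B) (hv : v ≠ 0) :
    ∫ x in Ioc A B, Real.exp (-(x * v)) = v⁻¹ * (Real.exp (-(A * v)) - Real.exp (-(B * v))) := by
  rw [← intervalIntegral.integral_of_le hAB]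
  have hd : ∀ x ∈ uIcc A B, HasDerivAt (fun x => -v⁻¹ * Real.exp (-(x * v)))
      (Real.exp (-(x * v))) x := by
    intro x _
    have := (((hasDerivAt_id x).mul_const v).neg.exp).const_mul (-v⁻¹)
    convert! this using 1
    simp
    field_simp
  rw [intervalIntegral.integral_eq_sub_of_hasDerivAt hd
    (Continuous.intervalIntegrable (by fun_prop) _ _)]
  ring

/-- Write `(exp(-Av) - exp(-Bv))/v` as the integral of `exp(-xv)` over `x ∈ (A, B]` and apply
Fubini. The `v`-integral is `Γ(1-p) x^(p-1)`, whose primitive needs `p ≠ 0`. Negative `p` is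
allowed. -/
theorem integrableOn_and_integral_rpow_mul_exp_sub_exp_of_le {p A B : ℝ} (hp : p < 1)
    (hp0 : p ≠ 0) (hA : 0 < A) (hAB : A ≤ B) :
    IntegrableOn (fun v : ℝ => v ^ (-p - 1) * (Real.exp (-(A * v)) - Real.exp (-(B * v))))
      (Ioi 0) ∧
    ∫ v in Ioi (0 : ℝ), v ^ (-p - 1) * (Real.exp (-(A * v)) - Real.exp (-(B * v))) =
      Real.Gamma (1 - p) / p * (B ^ p - A ^ p) := by
  have hI := integrableOn_prod_rpow_mul_exp (B := B) hp hA
  have hinner : ∀ v ∈ Ioi (0 : ℝ), ∫ x in Ioc A B, v ^ (-p) * Real.exp (-(x * v)) =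
      v ^ (-p - 1) * (Real.exp (-(A * v)) - Real.exp (-(B * v))) := by
    intro v hv
    have hv : 0 < v := hv
    rw [integral_const_mul, integral_Ioc_exp_neg_mul hAB hv.ne', ← mul_assoc,
      Real.rpow_sub_one hv.ne', div_eq_mul_inv]
  refine ⟨IntegrableOn.congr_fun hI.integral_prod_right hinner measurableSet_Ioi, ?_⟩
  rw [← setIntegral_congr_fun measurableSet_Ioi hinner, ← integral_integral_swap hI]
  have houter : ∀ x ∈ Ioc A B, ∫ v in Ioi (0 : ℝ), v ^ (-p) * Real.exp (-(x * v)) =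
      Real.Gamma (1 - p) * x ^ (p - 1) := by
    intro x hx
    have hx0 : 0 < x := hA.trans hx.1
    have := Real.integral_rpow_mul_exp_neg_mul_Ioi (a := 1 - p) (r := x) (by linarith) hx0
    rw [show 1 - p - 1 = -p by ring] at this
    rw [this, one_div, Real.inv_rpow hx0.le, ← Real.rpow_neg hx0.le, neg_sub, mul_comm]
  rw [setIntegral_congr_fun measurableSet_Ioc houter, integral_const_mul,
    ← intervalIntegral.integral_of_le hAB, integral_rpow]
  · rw [sub_add_cancel]
    ring
  · right
    refine ⟨fun h => hp0 (by linarith), ?_⟩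
    rw [uIcc_of_le hAB]
    exact fun h0 => absurd h0.1 (not_le.2 hA)

theorem integrableOn_and_integral_rpow_mul_exp_sub_exp {p A B : ℝ} (hp : p < 1)
    (hp0 : p ≠ 0) (hA : 0 < A) (hB : 0 < B) :
    IntegrableOn (fun v : ℝ => v ^ (-p - 1) * (Real.exp (-(A * v)) - Real.exp (-(B * v))))
      (Ioi 0) ∧
    ∫ v in Ioi (0 : ℝ), v ^ (-p - 1) * (Real.exp (-(A * v)) - Real.exp (-(B * v))) =
      Real.Gamma (1 - p) / p * (B ^ p - A ^ p) := by
  rcases le_total A B with hAB | hBA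
  · exact integrableOn_and_integral_rpow_mul_exp_sub_exp_of_le hp hp0 hA hAB
  · obtain ⟨h1, h2⟩ := integrableOn_and_integral_rpow_mul_exp_sub_exp_of_le hp hp0 hB hBA
    have he : (fun v : ℝ => v ^ (-p - 1) * (Real.exp (-(A * v)) - Real.exp (-(B * v)))) =
        fun v => -(v ^ (-p - 1) * (Real.exp (-(B * v)) - Real.exp (-(A * v)))) := by
      funext v
      ring
    rw [he, integral_neg, h2]
    exact ⟨h1.neg, by ring⟩

theorem integrableOn_and_integral_rpow_mul_exp_div_sub_exp_div {p A B : ℝ} (hp : p < 1)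
    (hp0 : p ≠ 0) (hA : 0 < A) (hB : 0 < B) :
    IntegrableOn (fun r : ℝ => r ^ (p - 1) * (Real.exp (-(A / r)) - Real.exp (-(B / r))))
      (Ioi 0) ∧
    ∫ r in Ioi (0 : ℝ), r ^ (p - 1) * (Real.exp (-(A / r)) - Real.exp (-(B / r))) =
      Real.Gamma (1 - p) / p * (B ^ p - A ^ p) := by
  obtain ⟨h1, h2⟩ := integrableOn_and_integral_rpow_mul_exp_sub_exp hp hp0 hA hB
  -- Substitution `v = 1/r`, with Jacobian `r^(-2)`.
  have he : ∀ r ∈ Ioi (0 : ℝ), (|(-1 : ℝ)| * r ^ ((-1 : ℝ) - 1)) •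
      ((r ^ (-1 : ℝ)) ^ (-p - 1) * (Real.exp (-(A * r ^ (-1 : ℝ))) -
        Real.exp (-(B * r ^ (-1 : ℝ))))) =
      r ^ (p - 1) * (Real.exp (-(A / r)) - Real.exp (-(B / r))) := by
    intro r hr
    have hr : 0 < r := hr
    rw [← Real.rpow_mul hr.le, Real.rpow_neg_one, smul_eq_mul, abs_neg, abs_one, one_mul,
      ← mul_assoc, ← Real.rpow_add hr, div_eq_mul_inv, div_eq_mul_inv]
    congr 2
    ring
  rw [← integral_comp_rpow_Ioi _ (by norm_num : (-1 : ℝ) ≠ 0),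
    setIntegral_congr_fun measurableSet_Ioi he] at h2
  refine ⟨?_, h2⟩
  rw [← integrableOn_Ioi_comp_rpow_iff _ (by norm_num : (-1 : ℝ) ≠ 0)] at h1
  exact h1.congr_fun he measurableSet_Ioi

theorem iUnion_Icc_inv_natCast_add_one :
    ⋃ n : ℕ, Icc ((n : ℝ) + 1)⁻¹ ((n : ℝ) + 1) = Ioi 0 := by
  ext x
  simp only [mem_iUnion, mem_Icc, mem_Ioi]
  constructor
  · rintro ⟨n, h, -⟩
    exact lt_of_lt_of_le (by positivity) h
  · intro hx
    obtain ⟨n, hn⟩ := exists_nat_ge (max x x⁻¹)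
    refine ⟨n, ?_, ?_⟩
    · rw [inv_le_comm₀ (by positivity) hx]
      linarith [le_max_right x x⁻¹]
    · linarith [le_max_left x x⁻¹]

theorem monotone_Icc_inv_natCast_add_one :
    Monotone fun n : ℕ => Icc ((n : ℝ) + 1)⁻¹ ((n : ℝ) + 1) := by
  intro m n hmn
  have : (m : ℝ) ≤ n := by exact_mod_cast hmn
  refine Icc_subset_Icc ?_ (by linarith)
  gcongr

theorem tendsto_setIntegral_Icc_inv_natCast_add_one {f : ℝ → ℝ} (hf : IntegrableOn f (Ioi 0)) :
    Filter.Tendsto (fun n : ℕ => ∫ r in Icc ((n : ℝ) + 1)⁻¹ ((n : ℝ) + 1), f r) Filter.atTop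
      (nhds (∫ r in Ioi 0, f r)) := by
  rw [← iUnion_Icc_inv_natCast_add_one] at hf ⊢
  exact tendsto_setIntegral_of_monotone (fun n => measurableSet_Icc)
    monotone_Icc_inv_natCast_add_one hf

/-- The Fourier integral commutes with integration over a parameter. -/
theorem fourier_integral_eq {N : ℕ} {α : Type*} [MeasurableSpace α] {μ : Measure α} [SFinite μ]
    {F : α → EuclideanSpace ℝ (Fin N) → ℂ}
    (hF : Integrable (Function.uncurry F) (μ.prod volume)) (w : EuclideanSpace ℝ (Fin N)) :
    𝓕 (fun ξ => ∫ r, F r ξ ∂μ) w = ∫ r, 𝓕 (F r) w ∂μ := by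
  simp only [Real.fourier_eq']
  simp_rw [← integral_smul]
  rw [integral_integral_swap]
  refine (hF.swap.bdd_smul (C := 1) (φ := fun z : EuclideanSpace ℝ (Fin N) × α =>
    Complex.exp (↑(-2 * Real.pi * inner ℝ z.1 w) * Complex.I)) ?_ ?_)
  · apply Measurable.aestronglyMeasurable
    fun_prop
  · exact ae_of_all _ fun z => by rw [Complex.norm_exp_ofReal_mul_I]

/-! ### Fourier transform of the harmonizable kernel. -/

section HarmonizableTransform

variable {N : ℕ}

/-- The Gaussian functions whose superposition over `r > 0` is a multiple of the harmonizable
kernel. -/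
noncomputable def gaussianHarmonizable (N : ℕ) (h : ℝ) (t : EuclideanSpace ℝ (Fin N)) (r : ℝ)
    (ξ : EuclideanSpace ℝ (Fin N)) : ℂ :=
  ((r ^ ((h + N / 2) / 2 - 1) * Real.exp (-(r * ‖ξ‖ ^ 2)) : ℝ) : ℂ) *
    (Complex.exp (Complex.I * ((inner ℝ t ξ : ℝ) : ℂ)) - 1)

theorem measurable_gaussianHarmonizable (h : ℝ) (t : EuclideanSpace ℝ (Fin N)) :
    Measurable (Function.uncurry (gaussianHarmonizable N h t)) := by
  unfold gaussianHarmonizable Function.uncurry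
  fun_prop

theorem integrable_exp_neg_mul_norm_sq {b : ℝ} (hb : 0 < b) :
    Integrable fun ξ : EuclideanSpace ℝ (Fin N) => Real.exp (-(b * ‖ξ‖ ^ 2)) := by
  have := (GaussianFourier.integrable_cexp_neg_mul_sq_norm_add (b := (b : ℂ)) (by simpa using hb) 0
    (0 : EuclideanSpace ℝ (Fin N))).norm
  refine this.congr (ae_of_all _ fun ξ => ?_)
  simp only [Complex.norm_exp, zero_mul, add_zero]
  congr 1
  norm_cast
  simp

/-- For `r ≥ a` the Gaussian `exp(-a‖ξ‖²)` dominates uniformly; this is what the cutoff away from `r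
= 0` buys. -/
theorem integrable_gaussianHarmonizable {a b : ℝ} (ha : 0 < a) (h : ℝ)
    (t : EuclideanSpace ℝ (Fin N)) :
    Integrable (Function.uncurry (gaussianHarmonizable N h t))
      ((volume.restrict (Icc a b)).prod volume) := by
  have h1 : IntegrableOn (fun r : ℝ => r ^ ((h + N / 2) / 2 - 1)) (Icc a b) := by
    refine ContinuousOn.integrableOn_Icc fun r hr => ?_
    exact (Real.continuousAt_rpow_const _ _ (Or.inl (ha.trans_le hr.1).ne')).continuousWithinAt
  have h2 := (h1.mul_prod (integrable_exp_neg_mul_norm_sq (N := N) ha)).mul_const 2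
  refine h2.mono' (measurable_gaussianHarmonizable h t).aestronglyMeasurable ?_
  rw [← Measure.restrict_univ (μ := (volume : Measure (EuclideanSpace ℝ (Fin N)))),
    Measure.prod_restrict, ae_restrict_iff' (measurableSet_Icc.prod MeasurableSet.univ)]
  refine ae_of_all _ fun z hz => ?_
  have hz1 : a ≤ z.1 := hz.1.1
  have hz0 : 0 < z.1 := ha.trans_le hz1
  have hexp : ‖Complex.exp (Complex.I * ((inner ℝ t z.2 : ℝ) : ℂ)) - 1‖ ≤ 2 := by
    refine (norm_sub_le _ _).trans ?_
    rw [mul_comm, Complex.norm_exp_ofReal_mul_I]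
    norm_num
  simp only [Function.uncurry, gaussianHarmonizable, norm_mul, Complex.norm_real]
  rw [Real.norm_of_nonneg (by positivity), Real.norm_of_nonneg (by positivity)]
  gcongr

/-- In the `2π` convention, `exp(i⟨t,ξ⟩)` is modulation by `(2π)⁻¹ t`, which translates the
transformed Gaussian. The factor `(π/r)^(N/2)` lowers the exponent of `r` from `s - 1` to `p - 1`.
-/
theorem fourier_gaussianHarmonizable {h r : ℝ} (hr : 0 < r) (t w : EuclideanSpace ℝ (Fin N)) :
    𝓕 (gaussianHarmonizable N h t r) w =
      ((Real.pi ^ ((N : ℝ) / 2) * (r ^ ((h - N / 2) / 2 - 1) *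
        (Real.exp (-(Real.pi ^ 2 * ‖(2 * Real.pi)⁻¹ • t - w‖ ^ 2 / r)) -
          Real.exp (-(Real.pi ^ 2 * ‖w‖ ^ 2 / r)))) : ℝ) : ℂ) := by
  have hr' : 0 < (r : ℂ).re := by simpa using hr
  set G : EuclideanSpace ℝ (Fin N) → EuclideanSpace ℝ (Fin N) → ℂ := fun x v =>
    Complex.exp (-(r : ℂ) * ‖v‖ ^ 2 + 2 * Real.pi * Complex.I * inner ℝ x v) with hG
  have hGi : ∀ x, Integrable (G x) := fun x =>
    GaussianFourier.integrable_cexp_neg_mul_sq_norm_add hr' _ x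
  have hGF : ∀ x, 𝓕 (G x) w = (((Real.pi / r) ^ ((N : ℝ) / 2) *
      Real.exp (-(Real.pi ^ 2 * ‖x - w‖ ^ 2 / r)) : ℝ) : ℂ) := by
    intro x
    rw [hG, fourier_gaussian_innerProductSpace' hr', finrank_euclideanSpace_fin]
    push_cast
    rw [Complex.ofReal_cpow (by positivity)]
    push_cast
    congr 2
    ring
  have hF : gaussianHarmonizable N h t r = ((r ^ ((h + N / 2) / 2 - 1) : ℝ) : ℂ) •
      (G ((2 * Real.pi)⁻¹ • t) - G 0) := by
    funext ξ
    simp only [gaussianHarmonizable, hG, Pi.smul_apply, Pi.sub_apply, smul_eq_mul,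
      inner_zero_left, Complex.ofReal_zero, mul_zero, Complex.exp_add, Complex.exp_zero,
      real_inner_smul_left]
    push_cast
    have : 2 * (Real.pi : ℂ) * Complex.I * ((2 * (Real.pi : ℂ))⁻¹ * (inner ℝ t ξ : ℝ)) =
        Complex.I * (inner ℝ t ξ : ℝ) := by
      have : (Real.pi : ℂ) ≠ 0 := by exact_mod_cast Real.pi_ne_zero
      field_simp
    rw [this, neg_mul]
    ring
  have hFF : 𝓕 (gaussianHarmonizable N h t r) w = ((r ^ ((h + N / 2) / 2 - 1) : ℝ) : ℂ) *
      (𝓕 (G ((2 * Real.pi)⁻¹ • t)) w - 𝓕 (G 0) w) := by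
    rw [hF]
    simp only [Real.fourier_eq]
    rw [← integral_sub ((Real.fourierIntegral_convergent_iff w).2 (hGi _))
      ((Real.fourierIntegral_convergent_iff w).2 (hGi _)), ← integral_const_mul]
    refine integral_congr_ae (ae_of_all _ fun v => ?_)
    simp only [Pi.smul_apply, Pi.sub_apply, smul_eq_mul, Circle.smul_def]
    ring
  rw [hFF, hGF, hGF, ← Complex.ofReal_sub, ← Complex.ofReal_mul, zero_sub, norm_neg]
  congr 1
  have hpow : r ^ ((h + N / 2) / 2 - 1) * (Real.pi / r) ^ ((N : ℝ) / 2) =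
      Real.pi ^ ((N : ℝ) / 2) * r ^ ((h - N / 2) / 2 - 1) := by
    rw [Real.div_rpow Real.pi_pos.le hr.le, mul_div_assoc', mul_comm, mul_div_assoc,
      ← Real.rpow_sub hr]
    congr 2
    ring
  rw [← mul_sub, ← mul_assoc, hpow, mul_assoc]

/-- The harmonizable kernel as a superposition of Gaussian functions, over `r ∈ s`. -/
theorem integral_gaussianHarmonizable (h : ℝ) (t ξ : EuclideanSpace ℝ (Fin N)) (s : Set ℝ) :
    ∫ r in s, gaussianHarmonizable N h t r ξ =
      ((∫ r in s, r ^ ((h + N / 2) / 2 - 1) * Real.exp (-(r * ‖ξ‖ ^ 2)) : ℝ) : ℂ) *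
        (Complex.exp (Complex.I * ((inner ℝ t ξ : ℝ) : ℂ)) - 1) := by
  simp only [gaussianHarmonizable]
  rw [integral_mul_const, integral_complex_ofReal]

theorem integrableOn_and_integral_rpow_mul_exp_neg_mul_norm_sq {h : ℝ} (hh : 0 < h)
    {ξ : EuclideanSpace ℝ (Fin N)} (hξ : ξ ≠ 0) :
    IntegrableOn (fun r : ℝ => r ^ ((h + N / 2) / 2 - 1) * Real.exp (-(r * ‖ξ‖ ^ 2))) (Ioi 0) ∧
    ∫ r in Ioi (0 : ℝ), r ^ ((h + N / 2) / 2 - 1) * Real.exp (-(r * ‖ξ‖ ^ 2)) =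
      Real.Gamma ((h + N / 2) / 2) * (‖ξ‖ ^ (h + (N : ℝ) / 2))⁻¹ := by
  have hn : 0 < ‖ξ‖ := norm_pos_iff.2 hξ
  have hs : 0 < (h + (N : ℝ) / 2) / 2 := by positivity
  constructor
  · have := integrableOn_rpow_mul_exp_neg_mul_rpow (s := (h + (N : ℝ) / 2) / 2 - 1) (p := 1)
      (b := ‖ξ‖ ^ 2) (by linarith) one_pos (by positivity)
    simpa [mul_comm] using this
  · have := Real.integral_rpow_mul_exp_neg_mul_Ioi hs (r := ‖ξ‖ ^ 2) (by positivity)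
    simp only [mul_comm _ (‖ξ‖ ^ 2)]
    rw [this, one_div, Real.inv_rpow (by positivity), ← Real.rpow_natCast, ← Real.rpow_mul hn.le,
      mul_comm]
    congr 3
    push_cast
    ring

theorem fourier_toLp_harmonizableKernel (hN : 1 ≤ N) {h : ℝ} (hh : h ∈ Ioo (0 : ℝ) 1)
    (hh' : h - N / 2 ≠ 0) (t : EuclideanSpace ℝ (Fin N)) :
    (𝓕 ((memLp_harmonizableKernel hN hh t).toLp (harmonizableKernel N h t)) : L2C N)
      =ᵐ[volume] fun w =>
        (((Real.Gamma ((h + N / 2) / 2))⁻¹ * (Real.pi ^ ((N : ℝ) / 2) *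
          (Real.Gamma (1 - (h - N / 2) / 2) / ((h - N / 2) / 2) *
          ((Real.pi ^ 2 * ‖w‖ ^ 2) ^ ((h - (N : ℝ) / 2) / 2) -
            (Real.pi ^ 2 * ‖(2 * Real.pi)⁻¹ • t - w‖ ^ 2) ^ ((h - (N : ℝ) / 2) / 2)))) : ℝ) :
              ℂ) := by
  have : Nonempty (Fin N) := ⟨⟨0, hN⟩⟩
  have hs : 0 < (h + (N : ℝ) / 2) / 2 := by
    have := hh.1
    positivity
  have hΓ : 0 < Real.Gamma ((h + N / 2) / 2) := Real.Gamma_pos_of_pos hs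
  have hp : (h - (N : ℝ) / 2) / 2 < 1 := by
    have : (0 : ℝ) ≤ N := N.cast_nonneg
    linarith [hh.2]
  have hp0 : (h - (N : ℝ) / 2) / 2 ≠ 0 := div_ne_zero hh' two_ne_zero
  have hne : ∀ a : EuclideanSpace ℝ (Fin N), ∀ᵐ x, x ≠ a := fun a => by
    simp [ae_iff, measure_singleton]
  have hint : ∀ n : ℕ, Integrable (Function.uncurry (gaussianHarmonizable N h t))
      ((volume.restrict (Icc ((n : ℝ) + 1)⁻¹ ((n : ℝ) + 1))).prod volume) := fun n =>
    integrable_gaussianHarmonizable (by positivity) h t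
  set f : ℕ → EuclideanSpace ℝ (Fin N) → ℂ := fun n ξ =>
    ∫ r in Icc ((n : ℝ) + 1)⁻¹ ((n : ℝ) + 1), gaussianHarmonizable N h t r ξ with hf
  set K : ℂ := (((Real.Gamma ((h + N / 2) / 2))⁻¹ : ℝ) : ℂ) with hK
  have hker : ∀ ξ : EuclideanSpace ℝ (Fin N), harmonizableKernel N h t ξ =
      K * (((Real.Gamma ((h + N / 2) / 2) * (‖ξ‖ ^ (h + (N : ℝ) / 2))⁻¹ : ℝ) : ℂ) *
        (Complex.exp (Complex.I * ((inner ℝ t ξ : ℝ) : ℂ)) - 1)) := by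
    intro ξ
    rw [← mul_assoc, hK, ← Complex.ofReal_mul, inv_mul_cancel_left₀ hΓ.ne', harmonizableKernel,
      Complex.ofReal_inv, div_eq_mul_inv, mul_comm]
  -- The `r`-integrand is nonnegative apart from the common factor `exp(i⟨t,ξ⟩) - 1`, so the
  -- truncations are dominated by the kernel itself.
  refine fourier_toLp_ae_eq_of_dominated (f := fun n => K • f n)
    (fun n => (hint n).integral_prod_right.smul K) _ ?_ ?_ ?_
  · intro n
    filter_upwards [hne 0] with ξ hξ
    obtain ⟨h1, h2⟩ := integrableOn_and_integral_rpow_mul_exp_neg_mul_norm_sq hh.1 hξ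
    rw [Pi.smul_apply, smul_eq_mul, hf, hker]
    simp only [integral_gaussianHarmonizable]
    rw [norm_mul, norm_mul, norm_mul, norm_mul, Complex.norm_real, ← h2]
    have hsub : Icc ((n : ℝ) + 1)⁻¹ ((n : ℝ) + 1) ⊆ Ioi 0 := by
      rw [← iUnion_Icc_inv_natCast_add_one]
      exact subset_iUnion (fun n : ℕ => Icc ((n : ℝ) + 1)⁻¹ ((n : ℝ) + 1)) n
    have hnn : ∀ r ∈ Ioi (0 : ℝ),
        0 ≤ r ^ ((h + (N : ℝ) / 2) / 2 - 1) * Real.exp (-(r * ‖ξ‖ ^ 2)) := by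
      intro r hr
      have : 0 < r := hr
      positivity
    gcongr
    rw [Complex.norm_real, Complex.norm_real,
      Real.norm_of_nonneg (setIntegral_nonneg measurableSet_Icc fun r hr => hnn r (hsub hr)),
      Real.norm_of_nonneg (setIntegral_nonneg measurableSet_Ioi hnn)]
    exact setIntegral_mono_set h1 ((ae_restrict_iff' measurableSet_Ioi).2 (ae_of_all _ hnn))
      hsub.eventuallyLE
  · filter_upwards [hne 0] with ξ hξ
    obtain ⟨h1, h2⟩ := integrableOn_and_integral_rpow_mul_exp_neg_mul_norm_sq hh.1 hξ
    rw [hker, ← h2]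
    simp only [Pi.smul_apply, smul_eq_mul, hf, integral_gaussianHarmonizable]
    exact (((Complex.continuous_ofReal.tendsto _).comp
      (tendsto_setIntegral_Icc_inv_natCast_add_one h1)).mul_const _).const_mul _
  · filter_upwards [hne 0, hne ((2 * Real.pi)⁻¹ • t)] with w hw hwt
    have hA : 0 < Real.pi ^ 2 * ‖(2 * Real.pi)⁻¹ • t - w‖ ^ 2 := by
      have := norm_pos_iff.2 (sub_ne_zero.2 hwt.symm)
      positivity
    have hB : 0 < Real.pi ^ 2 * ‖w‖ ^ 2 := by
      have := norm_pos_iff.2 hw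
      positivity
    obtain ⟨h1, h2⟩ := integrableOn_and_integral_rpow_mul_exp_div_sub_exp_div hp hp0 hA hB
    rw [← h2]
    have hFn : ∀ n, 𝓕 (K • f n) w = (((Real.Gamma ((h + N / 2) / 2))⁻¹ *
        (Real.pi ^ ((N : ℝ) / 2) * ∫ r in Icc ((n : ℝ) + 1)⁻¹ ((n : ℝ) + 1),
          r ^ ((h - (N : ℝ) / 2) / 2 - 1) *
          (Real.exp (-(Real.pi ^ 2 * ‖(2 * Real.pi)⁻¹ • t - w‖ ^ 2 / r)) -
            Real.exp (-(Real.pi ^ 2 * ‖w‖ ^ 2 / r)))) : ℝ) : ℂ) := by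
      intro n
      have hsmul : 𝓕 (K • f n) w = K * 𝓕 (f n) w := by
        simp only [Real.fourier_eq]
        rw [← integral_const_mul]
        refine integral_congr_ae (ae_of_all _ fun v => ?_)
        simp only [Pi.smul_apply, smul_eq_mul, Circle.smul_def]
        ring
      rw [hsmul, hf, fourier_integral_eq (hint n), Complex.ofReal_mul, ← hK,
        ← integral_const_mul (Real.pi ^ ((N : ℝ) / 2)), ← integral_complex_ofReal]
      congr 1
      refine setIntegral_congr_fun measurableSet_Icc fun r hr => ?_
      exact fourier_gaussianHarmonizable (lt_of_lt_of_le (by positivity) hr.1) t w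
    simp only [hFn]
    exact (Complex.continuous_ofReal.tendsto _).comp
      (((tendsto_setIntegral_Icc_inv_natCast_add_one h1).const_mul _).const_mul _)

end HarmonizableTransform

/-! ### Comparison of the two kernels. -/

theorem quasiMeasurePreserving_smul {N : ℕ} {r : ℝ} (hr : r ≠ 0) :
    Measure.QuasiMeasurePreserving (fun x : EuclideanSpace ℝ (Fin N) => r • x) := by
  refine ⟨measurable_const_smul _, ?_⟩
  rw [Measure.map_addHaar_smul volume hr]
  exact Measure.smul_absolutelyContinuous

/-- The factor between the moving average kernel and the Fourier transform of the harmonizable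
kernel. -/
noncomputable def harmonizableFactor (N : ℕ) (h : ℝ) : ℝ :=
  -((Real.Gamma ((h + N / 2) / 2))⁻¹ * Real.pi ^ ((N : ℝ) / 2) *
    (Real.Gamma (1 - (h - N / 2) / 2) / ((h - N / 2) / 2)) * (2⁻¹ : ℝ) ^ (h - (N : ℝ) / 2))

theorem harmonizableFactor_ne_zero {N : ℕ} {h : ℝ} (hh : h ∈ Ioo (0 : ℝ) 1)
    (hh' : h - N / 2 ≠ 0) : harmonizableFactor N h ≠ 0 := by
  have hN : (0 : ℝ) ≤ N := N.cast_nonneg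
  have h1 : 0 < Real.Gamma ((h + N / 2) / 2) := Real.Gamma_pos_of_pos (by linarith [hh.1])
  have h2 : 0 < Real.Gamma (1 - (h - N / 2) / 2) := Real.Gamma_pos_of_pos (by linarith [hh.2])
  have h3 : (h - (N : ℝ) / 2) / 2 ≠ 0 := div_ne_zero hh' two_ne_zero
  have h4 : (Real.pi ^ ((N : ℝ) / 2)) ≠ 0 := by positivity
  have h5 : ((2⁻¹ : ℝ) ^ (h - (N : ℝ) / 2)) ≠ 0 := by positivity
  exact neg_ne_zero.2 (mul_ne_zero (mul_ne_zero (mul_ne_zero (inv_ne_zero h1.ne') h4)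
    (div_ne_zero h2.ne' h3)) h5)

theorem fourierL2_toLp_harmonizableKernel {N : ℕ} (hN : 1 ≤ N) {h : ℝ} (hh : h ∈ Ioo (0 : ℝ) 1)
    (hh' : h - N / 2 ≠ 0) (t : EuclideanSpace ℝ (Fin N)) :
    fourierL2 ((memLp_harmonizableKernel hN hh t).toLp (harmonizableKernel N h t)) =ᵐ[volume]
      (harmonizableFactor N h : ℂ) • movingAverageKernel N h t := by
  have hr : (2 * Real.pi)⁻¹ ≠ 0 := by positivity
  -- Undoing the dilation: `π ‖(2π)⁻¹ v‖ = ‖v‖ / 2`, the source of the power of `2⁻¹` in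
  -- `harmonizableFactor`.
  have hscale : ∀ v : EuclideanSpace ℝ (Fin N),
      (Real.pi ^ 2 * ‖(2 * Real.pi)⁻¹ • v‖ ^ 2) ^ ((h - (N : ℝ) / 2) / 2) =
        (2⁻¹ : ℝ) ^ (h - (N : ℝ) / 2) * ‖v‖ ^ (h - (N : ℝ) / 2) := by
    intro v
    have e : Real.pi ^ 2 * ‖(2 * Real.pi)⁻¹ • v‖ ^ 2 = (2⁻¹ * ‖v‖) ^ (2 : ℝ) := by
      rw [norm_smul, Real.norm_of_nonneg (by positivity), Real.rpow_two]
      field_simp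
    rw [e, ← Real.rpow_mul (by positivity), mul_div_cancel₀ _ two_ne_zero,
      Real.mul_rpow (by norm_num) (norm_nonneg _)]
  filter_upwards [(memLp_comp_two_pi_inv_smul (𝓕 ((memLp_harmonizableKernel hN hh t).toLp
    (harmonizableKernel N h t)))).coeFn_toLp,
    (quasiMeasurePreserving_smul hr).ae (fourier_toLp_harmonizableKernel hN hh hh' t)] with u h1 h2
  rw [fourierL2, h1, h2, ← smul_sub, hscale, hscale, Pi.smul_apply, movingAverageKernel,
    smul_eq_mul, ← Complex.ofReal_mul, harmonizableFactor]
  congr 1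
  ring

/-- Both powers have exponent zero, and `0 ^ 0 = 1` covers `u = 0` and `u = t` as well. -/
theorem movingAverageKernel_of_eq {N : ℕ} {h : ℝ} (hh : h - N / 2 = 0)
    (t : EuclideanSpace ℝ (Fin N)) : movingAverageKernel N h t = 0 := by
  funext u
  simp [movingAverageKernel, hh]

/-- No estimate is needed: off the degenerate exponent the kernel is a multiple of the Fourier
transform of an `L²` function. -/
theorem memLp_movingAverageKernel {N : ℕ} (hN : 1 ≤ N) {h : ℝ} (hh : h ∈ Ioo (0 : ℝ) 1)
    (t : EuclideanSpace ℝ (Fin N)) : MemLp (movingAverageKernel N h t) 2 volume := by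
  by_cases hh' : h - (N : ℝ) / 2 = 0
  · rw [movingAverageKernel_of_eq hh']
    exact MemLp.zero
  · have h0 : (harmonizableFactor N h : ℂ) ≠ 0 :=
      Complex.ofReal_ne_zero.2 (harmonizableFactor_ne_zero hh hh')
    have h1 := ((Lp.memLp _).ae_eq (fourierL2_toLp_harmonizableKernel hN hh hh' t)).const_smul
      (harmonizableFactor N h : ℂ)⁻¹
    rwa [inv_smul_smul₀ h0] at h1

/-- The factor `c` in `Y = c X`; it vanishes where the moving average kernel does. -/
noncomputable def movingAverageFactor (N : ℕ) (h : ℝ) : ℝ :=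
  if h - (N : ℝ) / 2 = 0 then 0 else (harmonizableFactor N h)⁻¹

theorem toLp_movingAverageKernel {N : ℕ} (hN : 1 ≤ N) {h : ℝ} (hh : h ∈ Ioo (0 : ℝ) 1)
    (t : EuclideanSpace ℝ (Fin N)) :
    (memLp_movingAverageKernel hN hh t).toLp (movingAverageKernel N h t) =
      (movingAverageFactor N h : ℂ) •
        fourierL2 ((memLp_harmonizableKernel hN hh t).toLp (harmonizableKernel N h t)) := by
  by_cases hh' : h - (N : ℝ) / 2 = 0
  · simp only [movingAverageFactor, hh', if_true, Complex.ofReal_zero, zero_smul]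
    rw [Lp.eq_zero_iff_ae_eq_zero]
    refine (MemLp.coeFn_toLp _).trans ?_
    rw [movingAverageKernel_of_eq hh']
  · have h0 : (harmonizableFactor N h : ℂ) ≠ 0 :=
      Complex.ofReal_ne_zero.2 (harmonizableFactor_ne_zero hh hh')
    refine Lp.ext ?_
    filter_upwards [(memLp_movingAverageKernel hN hh t).coeFn_toLp,
      fourierL2_toLp_harmonizableKernel hN hh hh' t, Lp.coeFn_smul (movingAverageFactor N h : ℂ)
        (fourierL2 ((memLp_harmonizableKernel hN hh t).toLp (harmonizableKernel N h t)))]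
      with u h1 h2 h3
    rw [h1, h3, Pi.smul_apply, h2, movingAverageFactor, if_neg hh', Pi.smul_apply,
      Complex.ofReal_inv, inv_smul_smul₀ h0]

theorem toLp_harmonizableKernel_ne_zero {N : ℕ} (hN : 1 ≤ N) {h : ℝ} (hh : h ∈ Ioo (0 : ℝ) 1)
    {t : EuclideanSpace ℝ (Fin N)} (ht : t ≠ 0) :
    (memLp_harmonizableKernel hN hh t).toLp (harmonizableKernel N h t) ≠ 0 := by
  intro h0
  have h1 : harmonizableKernel N h t =ᵐ[volume] 0 :=
    (MemLp.coeFn_toLp (memLp_harmonizableKernel hN hh t)).symm.trans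
      ((Lp.eq_zero_iff_ae_eq_zero).1 h0)
  set U : Set (EuclideanSpace ℝ (Fin N)) :=
    {ξ | Complex.exp (Complex.I * ((inner ℝ t ξ : ℝ) : ℂ)) ≠ 1} with hU
  have hUo : IsOpen U := isOpen_ne_fun (by fun_prop) continuous_const
  have hUne : U.Nonempty := by
    -- Chosen so that its inner product with `t` is `π` and the exponential equals `-1`.
    refine ⟨(Real.pi / ‖t‖ ^ 2) • t, ?_⟩
    have : ‖t‖ ≠ 0 := norm_ne_zero_iff.2 ht
    rw [hU, mem_ofPred_eq, inner_smul_right, real_inner_self_eq_norm_sq,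
      div_mul_cancel₀ _ (pow_ne_zero 2 this), mul_comm, Complex.exp_pi_mul_I]
    norm_num
  have hpos : 0 < volume U := hUo.measure_pos volume hUne
  refine hpos.ne' (measure_mono_null (fun ξ hξ => ?_) h1)
  have hξ0 : ξ ≠ 0 := by
    rintro rfl
    simp [hU] at hξ
  have : (‖ξ‖ ^ (h + (N : ℝ) / 2)) ≠ 0 :=
    (Real.rpow_pos_of_pos (norm_pos_iff.2 hξ0) _).ne'
  exact div_ne_zero (sub_ne_zero.2 hξ) (Complex.ofReal_ne_zero.2 this)

theorem fourierL2_eq_zero {N : ℕ} {f : L2C N} (hf : fourierL2 f = 0) : f = 0 := by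
  have hr : (2 * Real.pi) ≠ 0 := by positivity
  have h1 : (fun x : EuclideanSpace ℝ (Fin N) => (𝓕 f : L2C N) ((2 * Real.pi)⁻¹ • x))
      =ᵐ[volume] 0 :=
    (MemLp.coeFn_toLp (memLp_comp_two_pi_inv_smul (𝓕 f))).symm.trans
      ((Lp.eq_zero_iff_ae_eq_zero).1 hf)
  have h2 : (𝓕 f : L2C N) = 0 := by
    rw [Lp.eq_zero_iff_ae_eq_zero]
    filter_upwards [(quasiMeasurePreserving_smul hr).ae h1] with x hx
    rwa [smul_smul, inv_mul_cancel₀ hr, one_smul] at hx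
  -- Plancherel.
  rw [← norm_eq_zero, ← Lp.norm_fourier_eq, h2, norm_zero]

end Kernels

/-! ### The comparison of the fields. -/

theorem mainTheorem5 (N : ℕ) (hN : 1 ≤ N) (H : EuclideanSpace ℝ (Fin N) → ℝ)
    (hH : Measurable H) (hH01 : ∀ t, H t ∈ Set.Ioo (0 : ℝ) 1) :
    (∀ t, MemLp (movingAverageKernel N (H t) t) 2 volume ∧
      MemLp (harmonizableKernel N (H t) t) 2 volume) ∧
    ∃ c : EuclideanSpace ℝ (Fin N) → ℝ,
      (∀ t, ¬ (N = 1 ∧ H t = 1 / 2) → c t ≠ 0) ∧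
      ∀ {Ω : Type*} [MeasurableSpace Ω] (P : Measure Ω) [IsProbabilityMeasure P]
        (W What : L2C N → Ω → ℂ), IsComplexIsonormal P W → IsFourierTransformOf P What W →
        ∀ T : Set (EuclideanSpace ℝ (Fin N)),
          -- every version of the one is, up to the factor `c`, a version of the other
          (∀ X Y : EuclideanSpace ℝ (Fin N) → Ω → ℂ,
            IsHarmonizableField P What H T X → IsMovingAverageField P W H T Y →
            ∀ t ∈ T, Y t =ᵐ[P] fun ω => (c t : ℂ) * X t ω) ∧
          -- there are versions that are indistinguishable up to the factor `c`
          (∃ X Y : EuclideanSpace ℝ (Fin N) → Ω → ℂ,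
            IsHarmonizableField P What H T X ∧ IsMovingAverageField P W H T Y ∧
            IndistinguishableOn P T Y (fun t ω => (c t : ℂ) * X t ω)) ∧
          -- all continuous versions are indistinguishable up to the factor `c`
          (∀ X Y : EuclideanSpace ℝ (Fin N) → Ω → ℂ,
            IsHarmonizableField P What H T X → IsMovingAverageField P W H T Y →
            (∀ᵐ ω ∂P, ContinuousOn (fun t => X t ω) T) →
            (∀ᵐ ω ∂P, ContinuousOn (fun t => Y t ω) T) →
            IndistinguishableOn P T Y (fun t ω => (c t : ℂ) * X t ω)) := by
  refine ⟨fun t => ⟨memLp_movingAverageKernel hN (hH01 t) t, memLp_harmonizableKernel hN (hH01 t) t⟩,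
    fun t => movingAverageFactor N (H t), fun t ht => ?_, ?_⟩
  · have h0 : H t - (N : ℝ) / 2 ≠ 0 := by
      intro h
      have h1 : (N : ℝ) < 2 := by linarith [(hH01 t).2]
      have h2 : N < 2 := by exact_mod_cast h1
      have h3 : N = 1 := by omega
      refine ht ⟨h3, ?_⟩
      rw [h3] at h
      push_cast at h
      linarith
    simp only [movingAverageFactor, if_neg h0]
    exact inv_ne_zero (harmonizableFactor_ne_zero (hH01 t) h0)
  intro Ω _ P _ W What hW hWhat T
  have hma : ∀ t, noiseIntegral W (movingAverageKernel N (H t) t) =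
      W ((memLp_movingAverageKernel hN (hH01 t) t).toLp _) := fun t =>
    dif_pos (memLp_movingAverageKernel hN (hH01 t) t)
  have hhk : ∀ t, noiseIntegral What (harmonizableKernel N (H t) t) =ᵐ[P]
      W (fourierL2 ((memLp_harmonizableKernel hN (hH01 t) t).toLp _)) := fun t => by
    rw [noiseIntegral, dif_pos (memLp_harmonizableKernel hN (hH01 t) t)]
    exact hWhat _
  have key : ∀ t, noiseIntegral W (movingAverageKernel N (H t) t) =ᵐ[P] fun ω =>
      (movingAverageFactor N (H t) : ℂ) *
        noiseIntegral What (harmonizableKernel N (H t) t) ω := by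
    intro t
    rw [hma, toLp_movingAverageKernel hN (hH01 t)]
    filter_upwards [hW.map_smul (movingAverageFactor N (H t) : ℂ)
      (fourierL2 ((memLp_harmonizableKernel hN (hH01 t) t).toLp _)), hhk t] with ω h1 h2
    rw [h1, h2]
  have hmod : ∀ X Y : EuclideanSpace ℝ (Fin N) → Ω → ℂ,
      IsHarmonizableField P What H T X → IsMovingAverageField P W H T Y →
      ∀ t ∈ T, Y t =ᵐ[P] fun ω => (movingAverageFactor N (H t) : ℂ) * X t ω := by
    intro X Y hX hY t ht
    filter_upwards [hX t ht, hY t ht, key t] with ω h1 h2 h3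
    rw [h1, h2, h3]
  refine ⟨hmod, ?_, ?_⟩
  -- Taking `c X` itself as the version of `Y` makes the identity hold for every `ω`.
  · exact ⟨fun t => noiseIntegral What (harmonizableKernel N (H t) t),
      fun t ω => (movingAverageFactor N (H t) : ℂ) *
        noiseIntegral What (harmonizableKernel N (H t) t) ω,
      fun t _ => Filter.EventuallyEq.rfl, fun t _ => (key t).symm,
      Filter.Eventually.of_forall fun ω t _ => rfl⟩
  · intro X Y hX hY hXc hYc
    have hXY := hmod X Y hX hY
    -- At `t = 0` the harmonizable kernel vanishes, so no quotient is available and `c` may be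
    -- discontinuous there; this one point is covered by the fixed-`t` identity.
    have hX0 : ∀ t ∈ T \ {0}, ¬ X t =ᵐ[P] 0 := by
      intro t ht h0
      refine toLp_harmonizableKernel_ne_zero hN (hH01 t) ht.2
        (fourierL2_eq_zero (hW.eq_zero_of_ae_eq_zero ?_))
      exact (hhk t).symm.trans ((hX t ht.1).symm.trans h0)
    have hmain := ae_forall_eq_mul_of_continuousOn (T := T \ {0})
      (c := fun t => (movingAverageFactor N (H t) : ℂ)) (fun t ht => hXY t ht.1) hX0
      (hXc.mono fun ω h => h.mono Set.sdiff_subset) (hYc.mono fun ω h => h.mono Set.sdiff_subset)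
    have hzero : ∀ᵐ ω ∂P, (0 : EuclideanSpace ℝ (Fin N)) ∈ T →
        Y 0 ω = (movingAverageFactor N (H 0) : ℂ) * X 0 ω := by
      by_cases h0 : (0 : EuclideanSpace ℝ (Fin N)) ∈ T
      · exact (hXY 0 h0).mono fun ω h _ => h
      · exact Filter.Eventually.of_forall fun ω h => absurd h h0
    filter_upwards [hmain, hzero] with ω h1 h2 t ht
    by_cases ht0 : t = 0
    · subst ht0
      exact h2 ht
    · exact h1 t ⟨ht, ht0⟩
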